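/- Let $V,E$ be sets and let each $e\in E$ have an initial vertex $\partial_-e\in V$ and a terminal vertex $\partial_+e\in V$ (self-loops, multiple edges and infinite graphs are allowed). Let $X$ be the corresponding equilateral metric graph, in which every edge $e$ is a copy $I_e$ of $[0,1]$, with $0$ at $\partial_-e$ and $1$ at $\partial_+e$. **Vertex spaces.** Let $E_v$ be the disjoint union of $\{e:\partial_-e=v\}$ and $\{e:\partial_+e=v\}$. Let $\mathcal G^{\max}=\bigoplus_{v}\mathbb C^{E_v}$ be the Hilbert space of families $F=(F_e(v))_{v\in V,\,e\in E_v}$ with $\|F\|^2=\sum_v\sum_{e\in E_v}|F_e(v)|^2<\infty$. Let $\mathcal G\subseteq\mathcal G^{\max}$ be a closed subspace (for instance $\mathcal G=\bigoplus_v\mathcal G_v$ with $\mathcal G_v\subseteq\mathbb C^{E_v}$), and let $P$ be the orthogonal projection onto $\mathcal G$. Put $d_{\mathcal G}:\mathcal G\to\ell^2(E)$, $(d_{\mathcal G}F)_e=F_e(\partial_+e)-F_e(\partial_-e)$, and $\Delta_{\mathcal G}=d_{\mathcal G}^*d_{\mathcal G}$, a bounded operator on $\mathcal G$. **Operators on $X$.**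 Let $L^2(X)=\bigoplus_eL^2(I_e)$ and $H^k_{\max}(X)=\bigoplus_eH^k(I_e)$. For $f\in H^1_{\max}(X)$ put $f_e(\partial_-e)=f_e(0)$ and $f_e(\partial_+e)=f_e(1)$, and write $\underline f\in\mathcal G^{\max}$ for the family of all these values; let $\vec{\underline f}\in\mathcal G^{\max}$ be the family with $-f_e(0)$ at $\partial_-e$ and $f_e(1)$ at $\partial_+e$. Let $H^2_{\mathcal G}(X)=\{f\in H^2_{\max}(X):\underline f\in\mathcal G\}$. For $m\in\mathbb R$ let $\tilde\Delta$ be the operator in $L^2(X)\oplus L^2(X)$ with domain $H^2_{\mathcal G}(X)\oplus H^2_{\mathcal G}(X)$ that acts in each component and on each edge as $f_e\mapsto-f_e''+m^2f_e$. For $f=(f_0,f_1)$ in this domain let $\tilde\Gamma_0f=(\underline{f_0},\underline{f_1})$ and $\tilde\Gamma_1f=(P\vec{\underline{f_0'}},P\vec{\underline{f_1'}})$, both in $\mathcal G\oplus\mathcal G\cong\mathcal G\otimes\mathbb C^2$. For a bounded self-adjoint operator $\tilde M$ on $\mathcal G\oplus\mathcal G$ let $\tilde\Delta^{\tilde M}$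 be the restriction of $\tilde\Delta$ to $\{f\in\operatorname{dom}\tilde\Delta:\tilde\Gamma_1f=\tilde M\tilde\Gamma_0f\}$. **Theorem.** Let $\lambda\in\mathbb C$ with $\lambda\ne(\pi k)^2+m^2$ for all $k=1,2,\dots$. Then $$\lambda\in\sigma(\tilde\Delta^{\tilde M})\iff 0\in\sigma\Big(\big(\Delta_{\mathcal G}-(1-\cos\sqrt{\lambda-m^2})\big)\otimes\mathrm{id}_{\mathbb C^2}-(\mathrm{sinc}\sqrt{\lambda-m^2})\,\tilde M\Big),$$ where $\mathrm{sinc}\,w=\sin w/w$ for $w\neq0$ and $\mathrm{sinc}\,0=1$. (As $\cos$ and $\mathrm{sinc}$ are even, the choice of the square root does not matter.) -/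

import Mathlib

open MeasureTheory

noncomputable section

namespace QuantumGraph

/-! ### The Sobolev space of order one on the unit interval -/

/-- Lebesgue measure on the edge interval `I = [0, 1]`. -/
def edgeMeasure : Measure ℝ := volume.restrict (Set.Icc 0 1)

/-- The Hilbert space `L²(I)` of one edge of length one. -/
abbrev EdgeL2 : Type := Lp ℂ 2 edgeMeasure

/-- `f ∈ L²(I)` is represented by the absolutely continuous function `x ↦ c + ∫₀ˣ g`, that is,
`f` has the derivative `g ∈ L²(I)` and the boundary value `f(0) = c`. -/
def IsPrimitive (f : EdgeL2) (c : ℂ) (g : EdgeL2) : Prop :=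
  ∀ᵐ x ∂edgeMeasure, f x = c + ∫ t in (0 : ℝ)..x, g t

instance : IsProbabilityMeasure edgeMeasure := ⟨by simp [edgeMeasure]⟩

theorem integrable_edge (g : EdgeL2) : Integrable g edgeMeasure :=
  (Lp.memLp g).integrable (by norm_num)

theorem intervalIntegrable_edge (g : EdgeL2) {x : ℝ} (hx : x ∈ Set.Icc (0 : ℝ) 1) :
    IntervalIntegrable g volume 0 x := by
  rw [intervalIntegrable_iff_integrableOn_Ioc_of_le hx.1]
  exact IntegrableOn.mono_set (integrable_edge g)
    (fun t ht => ⟨ht.1.le, ht.2.trans hx.2⟩)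

theorem edge_ae_mem : ∀ᵐ x ∂edgeMeasure, x ∈ Set.Icc (0 : ℝ) 1 :=
  ae_restrict_mem measurableSet_Icc

theorem intervalIntegral_congr_edge {u v : ℝ → ℂ} (h : u =ᵐ[edgeMeasure] v) {x : ℝ}
    (hx : x ∈ Set.Icc (0 : ℝ) 1) : ∫ t in (0 : ℝ)..x, u t = ∫ t in (0 : ℝ)..x, v t := by
  rw [intervalIntegral.integral_of_le hx.1, intervalIntegral.integral_of_le hx.1]
  refine integral_congr_ae (ae_restrict_of_ae_restrict_of_subset ?_ h)
  exact fun t ht => ⟨ht.1.le, ht.2.trans hx.2⟩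

theorem intervalIntegral_add_edge (g h : EdgeL2) {x : ℝ} (hx : x ∈ Set.Icc (0 : ℝ) 1) :
    ∫ t in (0 : ℝ)..x, (g + h : EdgeL2) t =
      (∫ t in (0 : ℝ)..x, g t) + ∫ t in (0 : ℝ)..x, h t := by
  rw [intervalIntegral_congr_edge (Lp.coeFn_add g h) hx]
  exact intervalIntegral.integral_add (intervalIntegrable_edge g hx)
    (intervalIntegrable_edge h hx)

theorem intervalIntegral_smul_edge (a : ℂ) (g : EdgeL2) {x : ℝ} (hx : x ∈ Set.Icc (0 : ℝ) 1) :
    ∫ t in (0 : ℝ)..x, (a • g : EdgeL2) t = a * ∫ t in (0 : ℝ)..x, g t := by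
  rw [intervalIntegral_congr_edge (Lp.coeFn_smul a g) hx]
  simp

theorem IsPrimitive.add {f₁ f₂ g₁ g₂ : EdgeL2} {c₁ c₂ : ℂ} (h₁ : IsPrimitive f₁ c₁ g₁)
    (h₂ : IsPrimitive f₂ c₂ g₂) : IsPrimitive (f₁ + f₂) (c₁ + c₂) (g₁ + g₂) := by
  filter_upwards [h₁, h₂, Lp.coeFn_add f₁ f₂, edge_ae_mem] with x e₁ e₂ e hx
  rw [e, intervalIntegral_add_edge _ _ hx, Pi.add_apply, e₁, e₂]
  ring

theorem IsPrimitive.smul (a : ℂ) {f g : EdgeL2} {c : ℂ} (h : IsPrimitive f c g) :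
    IsPrimitive (a • f) (a * c) (a • g) := by
  filter_upwards [h, Lp.coeFn_smul a f, edge_ae_mem] with x e₁ e hx
  rw [e, intervalIntegral_smul_edge _ _ hx, Pi.smul_apply, e₁, smul_eq_mul]
  ring

theorem isPrimitive_zero : IsPrimitive 0 0 0 := by
  filter_upwards [Lp.coeFn_zero ℂ 2 edgeMeasure, edge_ae_mem] with x e hx
  rw [intervalIntegral_congr_edge (Lp.coeFn_zero ℂ 2 edgeMeasure) hx, e]
  simp

theorem IsPrimitive.eq_zero {c : ℂ} {g : EdgeL2} (h : IsPrimitive 0 c g) : c = 0 ∧ g = 0 := by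
  have hii := intervalIntegrable_edge g (x := 1) (by simp)
  have hcont : ContinuousOn (fun x => c + ∫ t in (0 : ℝ)..x, g t) (Set.Icc (0 : ℝ) 1) := by
    refine continuousOn_const.add ?_
    have := intervalIntegral.continuousOn_primitive_interval' hii (a := (0 : ℝ)) Set.left_mem_uIcc
    rwa [Set.uIcc_of_le zero_le_one] at this
  have hz : Set.EqOn (fun x => c + ∫ t in (0 : ℝ)..x, g t) (fun _ => 0) (Set.Icc (0 : ℝ) 1) := by
    refine Measure.eqOn_Icc_of_ae_eq volume zero_ne_one ?_ hcont continuousOn_const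
    have h' : ∀ᵐ x ∂edgeMeasure, c + ∫ t in (0 : ℝ)..x, g t = 0 := by
      filter_upwards [h, Lp.coeFn_zero ℂ 2 edgeMeasure] with x e e0
      rw [← e, e0]; rfl
    exact h'
  have hc : c = 0 := by simpa using hz (Set.left_mem_Icc.2 (zero_le_one (α := ℝ)))
  subst hc
  refine ⟨rfl, ?_⟩
  refine Lp.ext ?_
  have hd := hii.ae_hasDerivAt_integral
  have h01 : ∀ᵐ x : ℝ, x ≠ 0 ∧ x ≠ 1 := by
    have h0 : ∀ᵐ x : ℝ, x ≠ 0 := by simp [ae_iff]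
    have h1 : ∀ᵐ x : ℝ, x ≠ 1 := by simp [ae_iff]
    filter_upwards [h0, h1] with x a b using ⟨a, b⟩
  filter_upwards [ae_restrict_of_ae hd, ae_restrict_of_ae h01, edge_ae_mem,
    Lp.coeFn_zero ℂ 2 edgeMeasure] with x hx hne hmem e0
  rw [e0, Pi.zero_apply]
  have hD := hx (by rwa [Set.uIcc_of_le zero_le_one]) 0 (by simp)
  have hloc : (fun x => ∫ t in (0 : ℝ)..x, g t) =ᶠ[nhds x] fun _ => 0 := by
    filter_upwards [Icc_mem_nhds (lt_of_le_of_ne hmem.1 hne.1.symm)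
      (lt_of_le_of_ne hmem.2 hne.2)] with y hy
    simpa using hz hy
  exact hD.unique ((hasDerivAt_const x (0 : ℂ)).congr_of_eventuallyEq hloc)

theorem IsPrimitive.unique {f g₁ g₂ : EdgeL2} {c₁ c₂ : ℂ} (h₁ : IsPrimitive f c₁ g₁)
    (h₂ : IsPrimitive f c₂ g₂) : c₁ = c₂ ∧ g₁ = g₂ := by
  have h := h₁.add (h₂.smul (-1))
  rw [show f + (-1 : ℂ) • f = 0 by simp] at h
  obtain ⟨hc, hg⟩ := h.eq_zero
  constructor
  · linear_combination hc
  · rwa [neg_one_smul, add_neg_eq_zero] at hg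

/-- The Sobolev space `H¹(I)`: all `f ∈ L²(I)` that are (represented by) an absolutely continuous
function on `[0, 1]` with derivative in `L²(I)`. -/
def EdgeH1 : Submodule ℂ EdgeL2 where
  carrier := {f | ∃ c g, IsPrimitive f c g}
  zero_mem' := ⟨0, 0, isPrimitive_zero⟩
  add_mem' := fun ⟨_, _, h₁⟩ ⟨_, _, h₂⟩ => ⟨_, _, h₁.add h₂⟩
  smul_mem' := fun a _ ⟨_, _, h⟩ => ⟨_, _, h.smul a⟩

theorem EdgeH1.exists_data (f : EdgeH1) : ∃ p : ℂ × EdgeL2, IsPrimitive f p.1 p.2 :=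
  let ⟨c, g, h⟩ := f.2
  ⟨(c, g), h⟩

/-- The boundary value `f(0)` together with the derivative `f'`. -/
def edgeData : EdgeH1 →ₗ[ℂ] ℂ × EdgeL2 where
  toFun f := (EdgeH1.exists_data f).choose
  map_add' f g := by
    have h := (EdgeH1.exists_data (f + g)).choose_spec.unique
      ((EdgeH1.exists_data f).choose_spec.add (EdgeH1.exists_data g).choose_spec)
    exact Prod.ext h.1 h.2
  map_smul' a f := by
    have h := (EdgeH1.exists_data (a • f)).choose_spec.unique
      ((EdgeH1.exists_data f).choose_spec.smul a)
    exact Prod.ext h.1 h.2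

theorem edgeData_spec (f : EdgeH1) : IsPrimitive f (edgeData f).1 (edgeData f).2 :=
  (EdgeH1.exists_data f).choose_spec

/-- The derivative `f ↦ f'` as a map from `H¹(I)` to `L²(I)`. -/
def edgeDeriv : EdgeH1 →ₗ[ℂ] EdgeL2 := LinearMap.snd ℂ ℂ EdgeL2 ∘ₗ edgeData

/-- The value at one of the two end points of the continuous representative of `f ∈ H¹(I)`:
`f(0)` for `false` and `f(1) = f(0) + ∫₀¹ f'` for `true`. -/
def edgeEval (b : Bool) : EdgeH1 →ₗ[ℂ] ℂ where
  toFun f := (edgeData f).1 + if b then ∫ t in (0 : ℝ)..1, edgeDeriv f t else 0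
  map_add' f g := by
    cases b
    · simp
    · simp only [map_add, Prod.fst_add, if_true]
      rw [intervalIntegral_add_edge _ _ (by simp)]
      ring
  map_smul' a f := by
    cases b
    · simp
    · simp only [map_smul, Prod.smul_fst, if_true, smul_eq_mul, RingHom.id_apply]
      rw [intervalIntegral_smul_edge _ _ (by simp)]
      ring

theorem norm_intervalIntegral_edge_le (g : EdgeL2) {x : ℝ} (hx : x ∈ Set.Icc (0 : ℝ) 1) :
    ‖∫ t in (0 : ℝ)..x, g t‖ ≤ ‖g‖ := by
  have h1 : ‖∫ t in (0 : ℝ)..x, g t‖ ≤ ∫ t, ‖g t‖ ∂edgeMeasure := by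
    refine (intervalIntegral.norm_integral_le_integral_norm hx.1).trans ?_
    rw [intervalIntegral.integral_of_le hx.1]
    exact setIntegral_mono_set (integrable_edge g).norm (Filter.Eventually.of_forall
      fun _ => norm_nonneg _) (LE.le.eventuallyLE
        (fun t (ht : t ∈ Set.Ioc 0 x) => ⟨ht.1.le, ht.2.trans hx.2⟩))
  refine h1.trans ?_
  rw [integral_norm_eq_lintegral_enorm (Lp.aestronglyMeasurable g), Lp.norm_def]
  refine ENNReal.toReal_mono (Lp.eLpNorm_ne_top g) ?_
  rw [← eLpNorm_one_eq_lintegral_enorm]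
  exact eLpNorm_le_eLpNorm_of_exponent_le (by norm_num) (Lp.aestronglyMeasurable g)

theorem norm_edgeEval_le (b : Bool) (f : EdgeH1) :
    ‖edgeEval b f‖ ≤ ‖(f : EdgeL2)‖ + 2 * ‖edgeDeriv f‖ := by
  have h0 : ‖(edgeData f).1‖ ≤ ‖(f : EdgeL2)‖ + ‖edgeDeriv f‖ := by
    have hae : ∀ᵐ x ∂edgeMeasure, (edgeData f).1 - (f : EdgeL2) x =
        -∫ t in (0 : ℝ)..x, edgeDeriv f t := by
      filter_upwards [edgeData_spec f] with x hx
      rw [hx]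
      simp [edgeDeriv]
    have hle : ‖∫ x, ((edgeData f).1 - (f : EdgeL2) x) ∂edgeMeasure‖ ≤
        ‖edgeDeriv f‖ * edgeMeasure.real Set.univ := by
      refine norm_integral_le_of_norm_le_const ?_
      filter_upwards [hae, edge_ae_mem] with x hx hm
      rw [hx, norm_neg]
      exact norm_intervalIntegral_edge_le _ hm
    rw [integral_sub (integrable_const _) (integrable_edge _)] at hle
    simp only [integral_const, probReal_univ, one_smul, mul_one] at hle
    have hf : ‖∫ x, (f : EdgeL2) x ∂edgeMeasure‖ ≤ ‖(f : EdgeL2)‖ := by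
      have := norm_intervalIntegral_edge_le (f : EdgeL2) (x := 1) (by simp)
      rw [intervalIntegral.integral_of_le zero_le_one, ← integral_Icc_eq_integral_Ioc] at this
      exact this
    calc ‖(edgeData f).1‖
        = ‖((edgeData f).1 - ∫ x, (f : EdgeL2) x ∂edgeMeasure) +
            ∫ x, (f : EdgeL2) x ∂edgeMeasure‖ := by rw [sub_add_cancel]
      _ ≤ _ := norm_add_le _ _
      _ ≤ _ := by linarith
  cases b
  · simp only [edgeEval, LinearMap.coe_mk, AddHom.coe_mk]
    have := norm_nonneg (edgeDeriv f)
    simp only [Bool.false_eq_true, if_false, add_zero]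
    linarith
  · simp only [edgeEval, LinearMap.coe_mk, AddHom.coe_mk, if_true]
    have := norm_intervalIntegral_edge_le (edgeDeriv f) (x := 1) (by simp)
    have := norm_add_le (edgeData f).1 (∫ t in (0 : ℝ)..1, edgeDeriv f t)
    linarith

/-! ### Graphs and discrete Laplacians -/

/-- An oriented graph with vertex set `V` and edge set `E`; self-loops and multiple edges are
allowed, and `V` and `E` may be infinite. As an equilateral metric graph, each edge `e` is a copy
of `[0, 1]`, with `0` at `∂₋ e = init e` and `1` at `∂₊ e = term e`. -/
structure EdgeGraph (V E : Type*) where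
  init : E → V
  term : E → V

namespace EdgeGraph

variable {V E : Type*} (X : EdgeGraph V E)

/-- The end point `∂₋ e` (for `false`) or `∂₊ e` (for `true`) of the edge `e`. -/
def bd (e : E) (b : Bool) : V := if b then X.term e else X.init e

/-- `E_v`, the disjoint union of the edges starting at `v` and of those ending at `v`. -/
def Star (v : V) : Type _ := {p : E × Bool // X.bd p.1 p.2 = v}

/-- The disjoint union of all `E_v`. -/
abbrev Incidence : Type _ := Σ v : V, X.Star v

variable {X} in
/-- The edge of an incidence. -/
def Incidence.edge (i : X.Incidence) : E := i.2.1.1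

variable {X} in
/-- The end of the edge that meets the vertex: `false` for `∂₋`, `true` for `∂₊`. -/
def Incidence.side (i : X.Incidence) : Bool := i.2.1.2

/-- The incidence at the vertex `∂± e`. -/
def inc (b : Bool) (e : E) : X.Incidence := ⟨X.bd e b, ⟨(e, b), rfl⟩⟩

theorem inc_injective (b : Bool) : Function.Injective (X.inc b) := fun e e' h => by
  have := congrArg (Incidence.edge (X := X)) h
  exact this

/-- The maximal vertex space `⨁_v ℂ^{E_v}` with the norm `∑_v ∑_{e ∈ E_v} |F_e(v)|²`. -/
abbrev GMax : Type _ := lp (fun _ : X.Incidence => ℂ) 2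

/-- The space `ℓ²(E)` of `1`-forms (all lengths are one). -/
abbrev EdgeForms (_X : EdgeGraph V E) : Type _ := lp (fun _ : E => ℂ) 2

theorem memlp_comp_inc (b : Bool) (F : X.GMax) : Memℓp (fun e : E => F (X.inc b e)) 2 := by
  refine memℓp_gen ?_
  exact ((lp.memℓp F).summable (by simp)).comp_injective (X.inc_injective b)

/-- The evaluation `F ↦ (F_e(∂± e))_e`. -/
def pull (b : Bool) : X.GMax →L[ℂ] X.EdgeForms :=
  LinearMap.mkContinuous
    { toFun := fun F => ⟨fun e => F (X.inc b e), X.memlp_comp_inc b F⟩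
      map_add' := fun _ _ => rfl
      map_smul' := fun _ _ => rfl } 1 (by
    intro F
    rw [one_mul]
    refine lp.norm_le_of_tsum_le (by simp) (norm_nonneg _) ?_
    rw [lp.norm_rpow_eq_tsum (by simp) F]
    exact Summable.tsum_le_tsum_of_inj (X.inc b) (X.inc_injective b)
      (fun _ _ => by positivity) (fun _ => le_rfl)
      (((lp.memℓp F).summable (by simp)).comp_injective (X.inc_injective b))
      ((lp.memℓp F).summable (by simp)))

/-- The exterior derivative `(d_𝒢 F)_e = F_e(∂₊ e) - F_e(∂₋ e)` on a vertex space `𝒢`. -/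
def extDeriv (G : Submodule ℂ X.GMax) : G →L[ℂ] X.EdgeForms :=
  (X.pull true - X.pull false) ∘L G.subtypeL

/-- The generalised discrete Laplacian `Δ_𝒢 = d_𝒢* d_𝒢` of a closed vertex space `𝒢`. -/
def discreteLaplacian (G : Submodule ℂ X.GMax) [CompleteSpace G] : G →L[ℂ] G :=
  ContinuousLinearMap.adjoint (X.extDeriv G) ∘L X.extDeriv G

/-! ### Function spaces on the equilateral metric graph -/

/-- `L²(X) = ⨁_e L²(I_e)`. -/
abbrev L2 (_X : EdgeGraph V E) : Type _ := lp (fun _ : E => EdgeL2) 2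

/-- The maximal Sobolev space `⨁_e H¹(I_e)`: edgewise `H¹`, with square-summable derivatives. -/
def H1Max : Submodule ℂ X.L2 where
  carrier := {f | ∃ h : ∀ e, f e ∈ EdgeH1, Memℓp (fun e => edgeDeriv ⟨f e, h e⟩) 2}
  zero_mem' := by
    refine ⟨fun e => EdgeH1.zero_mem, ?_⟩
    have : (fun e : E => edgeDeriv ⟨(0 : X.L2) e, EdgeH1.zero_mem⟩) = 0 :=
      funext fun e => edgeDeriv.map_zero
    rw [this]
    exact zero_memℓp
  add_mem' := by
    rintro f g ⟨hf, hf'⟩ ⟨hg, hg'⟩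
    refine ⟨fun e => EdgeH1.add_mem (hf e) (hg e), ?_⟩
    convert! hf'.add hg' using 1
    exact funext fun e => edgeDeriv.map_add ⟨f e, hf e⟩ ⟨g e, hg e⟩
  smul_mem' := by
    rintro a f ⟨hf, hf'⟩
    refine ⟨fun e => EdgeH1.smul_mem a (hf e), ?_⟩
    convert! hf'.const_smul a using 1
    exact funext fun e => edgeDeriv.map_smul a ⟨f e, hf e⟩

variable {X} in
/-- The component on the edge `e`. -/
def H1Max.comp (e : E) : X.H1Max →ₗ[ℂ] EdgeH1 where
  toFun f := ⟨f.1 e, f.2.1 e⟩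
  map_add' _ _ := rfl
  map_smul' _ _ := rfl

/-- The edgewise derivative `f ↦ f'`. -/
def deriv : X.H1Max →ₗ[ℂ] X.L2 where
  toFun f := ⟨fun e => edgeDeriv (H1Max.comp e f), f.2.2⟩
  map_add' f g := lp.ext (funext fun e => edgeDeriv.map_add (H1Max.comp e f) (H1Max.comp e g))
  map_smul' a f := lp.ext (funext fun e => edgeDeriv.map_smul a (H1Max.comp e f))

theorem memlp_trace (s : Bool → ℂ) (hs : ∀ b, ‖s b‖ ≤ 1) (f : X.H1Max) :
    Memℓp (fun i : X.Incidence => s i.side * edgeEval i.side (H1Max.comp i.edge f)) 2 := by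
  have hsum : Summable fun e : E => 2 * ‖f.1 e‖ ^ (2 : ℝ) + 8 * ‖X.deriv f e‖ ^ (2 : ℝ) := by
    have h1 := (lp.memℓp f.1).summable (by simp)
    have h2 := (lp.memℓp (X.deriv f)).summable (by simp)
    simp only [ENNReal.toReal_ofNat] at h1 h2
    exact (h1.mul_left 2).add (h2.mul_left 8)
  have hprod : Summable fun p : E × Bool =>
      (2 * ‖f.1 p.1‖ ^ (2 : ℝ) + 8 * ‖X.deriv f p.1‖ ^ (2 : ℝ)) * (1 : ℝ) :=
    hsum.mul_of_nonneg (g := fun _ : Bool => (1 : ℝ)) Summable.of_finite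
      (fun _ => by positivity) (fun _ => by simp)
  have hinj : Function.Injective fun i : X.Incidence => (i.edge, i.side) := by
    rintro ⟨v, ⟨⟨e, b⟩, h⟩⟩ ⟨v', ⟨⟨e', b'⟩, h'⟩⟩ hp
    obtain ⟨rfl, rfl⟩ := Prod.mk.injEq .. ▸ hp
    dsimp only at h h'
    subst h
    subst h'
    rfl
  refine memℓp_gen ?_
  simp only [ENNReal.toReal_ofNat]
  refine Summable.of_nonneg_of_le (fun _ => by positivity) (fun i => ?_)
    (hprod.comp_injective hinj)
  have hb := norm_edgeEval_le i.side (H1Max.comp i.edge f)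
  have h3 : ‖s i.side * edgeEval i.side (H1Max.comp i.edge f)‖ ≤
      ‖f.1 i.edge‖ + 2 * ‖X.deriv f i.edge‖ := by
    rw [norm_mul]
    exact (mul_le_of_le_one_left (norm_nonneg _) (hs _)).trans hb
  simp only [Function.comp_apply, mul_one, Real.rpow_two]
  nlinarith [norm_nonneg (s i.side * edgeEval i.side (H1Max.comp i.edge f)),
    sq_nonneg (‖f.1 i.edge‖ - 2 * ‖X.deriv f i.edge‖)]

/-- The unoriented evaluation `(f_e(v))_{v, e ∈ E_v}` at the vertices. -/
def trace : X.H1Max →ₗ[ℂ] X.GMax where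
  toFun f := ⟨fun i => edgeEval i.side (H1Max.comp i.edge f), by
    have h := X.memlp_trace (fun _ => 1) (by simp) f
    simp only [one_mul] at h
    exact h⟩
  map_add' f g := lp.ext (funext fun i =>
    (edgeEval i.side).map_add (H1Max.comp i.edge f) (H1Max.comp i.edge g))
  map_smul' a f := lp.ext (funext fun i => (edgeEval i.side).map_smul a (H1Max.comp i.edge f))

/-- The oriented evaluation at the vertices: `-f_e(0)` at `∂₋ e` and `f_e(1)` at `∂₊ e`. -/
def orientedTrace : X.H1Max →ₗ[ℂ] X.GMax where
  toFun f := ⟨fun i => (if i.side then 1 else -1) * edgeEval i.side (H1Max.comp i.edge f),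
    X.memlp_trace (fun b => if b then 1 else -1) (by simp) f⟩
  map_add' f g := lp.ext (funext fun i => by
    refine Eq.trans ?_ (mul_add _ (edgeEval i.side (H1Max.comp i.edge f))
      (edgeEval i.side (H1Max.comp i.edge g)))
    rw [← map_add, ← map_add])
  map_smul' a f := lp.ext (funext fun i => by
    refine Eq.trans ?_ (mul_left_comm _ a (edgeEval i.side (H1Max.comp i.edge f)))
    rw [← smul_eq_mul (a := a), ← map_smul, ← map_smul])

/-- The space `{f ∈ H²_max(X) | f_(v) ∈ 𝒢}`, where `H²_max(X)` consists of the `f ∈ H¹_max(X)`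
with `f' ∈ H¹_max(X)`. -/
def H2 (G : Submodule ℂ X.GMax) : Submodule ℂ X.L2 where
  carrier := {f | ∃ h : f ∈ X.H1Max, X.deriv ⟨f, h⟩ ∈ X.H1Max ∧ X.trace ⟨f, h⟩ ∈ G}
  zero_mem' := ⟨X.H1Max.zero_mem,
    (show X.deriv 0 ∈ X.H1Max by simp), (show X.trace 0 ∈ G by simp)⟩
  add_mem' := by
    rintro f g ⟨hf, hf', hf''⟩ ⟨hg, hg', hg''⟩
    refine ⟨X.H1Max.add_mem hf hg, ?_, ?_⟩
    · exact (X.deriv.map_add ⟨f, hf⟩ ⟨g, hg⟩) ▸ X.H1Max.add_mem hf' hg'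
    · exact (X.trace.map_add ⟨f, hf⟩ ⟨g, hg⟩) ▸ G.add_mem hf'' hg''
  smul_mem' := by
    rintro a f ⟨hf, hf', hf''⟩
    refine ⟨X.H1Max.smul_mem a hf, ?_, ?_⟩
    · exact (X.deriv.map_smul a ⟨f, hf⟩) ▸ X.H1Max.smul_mem a hf'
    · exact (X.trace.map_smul a ⟨f, hf⟩) ▸ G.smul_mem a hf''

variable (G : Submodule ℂ X.GMax)

/-- The derivative `f ↦ f'`, as a map from `H²_𝒢(X)` to `H¹_max(X)`. -/
def derivH2 : X.H2 G →ₗ[ℂ] X.H1Max where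
  toFun f := ⟨X.deriv ⟨f.1, f.2.1⟩, f.2.2.1⟩
  map_add' f g := Subtype.ext (X.deriv.map_add ⟨f.1, f.2.1⟩ ⟨g.1, g.2.1⟩)
  map_smul' a f := Subtype.ext (X.deriv.map_smul a ⟨f.1, f.2.1⟩)

/-- The metric graph Laplacian `(Δ f)_e = -f_e''` with domain `H²_𝒢(X)`. -/
def laplacian : X.L2 →ₗ.[ℂ] X.L2 where
  domain := X.H2 G
  toFun := -(X.deriv ∘ₗ X.derivH2 G)

/-- The boundary operator `Γ₀ f = (f_e(v))_{v, e ∈ E_v}`. -/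
def bdry0 : (X.laplacian G).domain →ₗ[ℂ] G where
  toFun f := ⟨X.trace ⟨f.1, f.2.1⟩, f.2.2.2⟩
  map_add' f g := Subtype.ext (X.trace.map_add ⟨f.1, f.2.1⟩ ⟨g.1, g.2.1⟩)
  map_smul' a f := Subtype.ext (X.trace.map_smul a ⟨f.1, f.2.1⟩)

/-- The boundary operator `Γ₁`: the orthogonal projection to `𝒢` of the oriented evaluation
of `f'`. -/
def bdry1 [CompleteSpace G] : (X.laplacian G).domain →ₗ[ℂ] G :=
  G.orthogonalProjectionOnto.toLinearMap ∘ₗ X.orientedTrace ∘ₗ X.derivH2 G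

/-! ### The Laplacian of the Dirac operator with symmetric components -/

/-- `L²(X) ⊗ ℂ² = L²(X) ⊕ L²(X)`. -/
abbrev L2Sym : Type _ := WithLp 2 (X.L2 × X.L2)

/-- The operator that acts as `Δ + m²` in both components, with domain `H²_𝒢(X) ⊗ ℂ²`. -/
def laplacianSym (m : ℝ) : X.L2Sym →ₗ.[ℂ] X.L2Sym where
  domain := (X.laplacian G).domain.comap (WithLp.fstₗ 2 ℂ X.L2 X.L2) ⊓
    (X.laplacian G).domain.comap (WithLp.sndₗ 2 ℂ X.L2 X.L2)
  toFun :=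
    { toFun := fun f => WithLp.toLp 2
        (X.laplacian G ⟨f.1.fst, f.2.1⟩ + (m : ℂ) ^ 2 • f.1.fst,
          X.laplacian G ⟨f.1.snd, f.2.2⟩ + (m : ℂ) ^ 2 • f.1.snd)
      map_add' := fun f g => by
        have h1 := (X.laplacian G).map_add ⟨f.1.fst, f.2.1⟩ ⟨g.1.fst, g.2.1⟩
        have h2 := (X.laplacian G).map_add ⟨f.1.snd, f.2.2⟩ ⟨g.1.snd, g.2.2⟩
        rw [← WithLp.toLp_add, Prod.mk_add_mk]
        congr 2
        · refine (congrArg₂ (· + ·) h1 (smul_add _ f.1.fst g.1.fst)).trans ?_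
          exact add_add_add_comm _ _ _ _
        · refine (congrArg₂ (· + ·) h2 (smul_add _ f.1.snd g.1.snd)).trans ?_
          exact add_add_add_comm _ _ _ _
      map_smul' := fun a f => by
        have h1 := (X.laplacian G).map_smul a ⟨f.1.fst, f.2.1⟩
        have h2 := (X.laplacian G).map_smul a ⟨f.1.snd, f.2.2⟩
        rw [RingHom.id_apply, ← WithLp.toLp_smul, Prod.smul_mk, smul_add, smul_add,
          smul_comm a, smul_comm a]
        congr 2
        · exact congrArg₂ (· + ·) h1 rfl
        · exact congrArg₂ (· + ·) h2 rfl }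

/-- The boundary space `𝒢 ⊗ ℂ² = 𝒢 ⊕ 𝒢`. -/
abbrev BdrySym : Type _ := WithLp 2 (G × G)

/-- A linear map that acts in both components. -/
def mapSym {p : Submodule ℂ X.L2} (T : p →ₗ[ℂ] G) :
    (p.comap (WithLp.fstₗ 2 ℂ X.L2 X.L2) ⊓ p.comap (WithLp.sndₗ 2 ℂ X.L2 X.L2) :
      Submodule ℂ X.L2Sym) →ₗ[ℂ] X.BdrySym G where
  toFun f := WithLp.toLp 2 (T ⟨f.1.fst, f.2.1⟩, T ⟨f.1.snd, f.2.2⟩)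
  map_add' f g := congrArg (WithLp.toLp 2) (Prod.ext
    (T.map_add ⟨f.1.fst, f.2.1⟩ ⟨g.1.fst, g.2.1⟩) (T.map_add ⟨f.1.snd, f.2.2⟩ ⟨g.1.snd, g.2.2⟩))
  map_smul' a f := congrArg (WithLp.toLp 2) (Prod.ext
    (T.map_smul a ⟨f.1.fst, f.2.1⟩) (T.map_smul a ⟨f.1.snd, f.2.2⟩))

/-- The boundary operator `Γ₀ ⊗ id`. -/
def bdrySym0 (m : ℝ) : (X.laplacianSym G m).domain →ₗ[ℂ] X.BdrySym G := X.mapSym G (X.bdry0 G)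

/-- The boundary operator `Γ₁ ⊗ id`. -/
def bdrySym1 [CompleteSpace G] (m : ℝ) : (X.laplacianSym G m).domain →ₗ[ℂ] X.BdrySym G :=
  X.mapSym G (X.bdry1 G)

/-- The restriction of `laplacianSym` to the functions with `(Γ₁ ⊗ id) f = M (Γ₀ ⊗ id) f`. -/
def laplacianSymRestr [CompleteSpace G] (m : ℝ) (M : X.BdrySym G →L[ℂ] X.BdrySym G) :
    X.L2Sym →ₗ.[ℂ] X.L2Sym :=
  (X.laplacianSym G m).domRestrict
    ((LinearMap.eqLocus (X.bdrySym1 G m) (M.toLinearMap ∘ₗ X.bdrySym0 G m)).map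
      (X.laplacianSym G m).domain.subtype)

/-- For a bounded operator `T` on `𝒢`, the operator `T ⊗ id` on `𝒢 ⊗ ℂ² = 𝒢 ⊕ 𝒢`. -/
def tensorId (T : G →L[ℂ] G) : X.BdrySym G →L[ℂ] X.BdrySym G :=
  (WithLp.prodContinuousLinearEquiv 2 ℂ G G).symm.toContinuousLinearMap ∘L
    (T.prodMap T) ∘L (WithLp.prodContinuousLinearEquiv 2 ℂ G G).toContinuousLinearMap

end EdgeGraph

/-! ### Spectra of unbounded operators -/

/-- The spectrum of an operator `A` in a Hilbert space: all `z` for which `A - z` is not a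
bijection from the domain of `A` onto the space with bounded inverse. -/
def pmapSpectrum {H : Type*} [NormedAddCommGroup H] [InnerProductSpace ℂ H]
    (A : H →ₗ.[ℂ] H) : Set ℂ :=
  {z | ¬ ∃ R : H →L[ℂ] H,
    (∀ y, ∃ h : R y ∈ A.domain, A ⟨R y, h⟩ - z • R y = y) ∧
      ∀ x : A.domain, R (A x - z • (x : H)) = x}

/-- The function `sin w / w`, continued by `1` to `w = 0`. -/
def csinc (w : ℂ) : ℂ := if w = 0 then 1 else Complex.sin w / w

end QuantumGraph

end

open MeasureTheory

noncomputable section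

namespace QuantumGraph

/-! ### Restrictions of an operator by boundary conditions -/

/-! Put μ = λ - m² = w². Away from the Dirichlet eigenvalues (πk)², k ≥ 1, of an edge, every F ∈ 𝒢
has exactly one extension f with -f'' = μf on each edge and vertex values F. If S(1) = sinc w and
C(1) = cos w are the values at 1 of the fundamental solutions and F₀, F₁ the values of F on an edge,
then S(1) f'(0) = F₁ - C(1)F₀ and S(1) f'(1) = C(1)F₁ - F₀. The oriented boundary family of f',
times S(1), is therefore (F₀ - F₁, F₁ - F₀) - (1 - C(1))(F₀, F₁), which projects to T F = (Δ_𝒢 - (1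
- cos w))F in 𝒢. So Γ₁f = MΓ₀f holds for this extension precisely when (T - sM)F = 0, with s = sinc
w.

Passing from kernels to spectra is a Krein-type argument, independent of graphs:
`WellPosed.mem_pmapSpectrum_iff` turns an inverse of T - sM into a resolvent and conversely. Its
input `WellPosed` is verified in `wellPosed_laplacian` by solving the equation on one edge with
bounds independent of the edge, so that the solution operators act diagonally on the ℓ² sums. Two
components only double all operators (`wellPosed_laplacianSym`); they are coupled through M alone.
-/

/-- The boundary value problem of `A` with the boundary maps `Γ₀` and `Γ₁` at the spectral
parameter `z` is well-posed: the Dirichlet problem is solved by bounded operators, and the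
Dirichlet-to-Neumann operator is `s⁻¹ T`. -/
structure WellPosed {H K : Type*} [NormedAddCommGroup H] [InnerProductSpace ℂ H]
    [NormedAddCommGroup K] [NormedSpace ℂ K] (A : H →ₗ.[ℂ] H) (Γ₀ Γ₁ : A.domain →ₗ[ℂ] K)
    (z s : ℂ) (T : K →L[ℂ] K) : Prop where
  poisson : ∃ P : K →L[ℂ] H, ∀ F, ∃ h : P F ∈ A.domain,
    A ⟨P F, h⟩ = z • P F ∧ Γ₀ ⟨P F, h⟩ = F ∧ s • Γ₁ ⟨P F, h⟩ = T F
  dirichlet : ∃ (D : H →L[ℂ] H) (B : H →L[ℂ] K), ∀ y, ∃ h : D y ∈ A.domain,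
    A ⟨D y, h⟩ = y + z • D y ∧ Γ₀ ⟨D y, h⟩ = 0 ∧ Γ₁ ⟨D y, h⟩ = B y
  unique : ∀ x : A.domain, A x = z • (x : H) → Γ₀ x = 0 → x = 0
  surjective : ∀ F, ∃ x : A.domain, Γ₀ x = 0 ∧ Γ₁ x = F

/-- Solutions of A x = z x are the vectors P F, and P F satisfies the boundary condition iff (T -
sM)F = 0. If T - sM has the inverse N, the resolvent is given by Krein's formula D - sPNB;
conversely, a resolvent solves (T - sM)G = F through a vector with prescribed boundary data. -/
theorem WellPosed.mem_pmapSpectrum_iff {H K : Type*} [NormedAddCommGroup H]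
    [InnerProductSpace ℂ H] [NormedAddCommGroup K] [NormedSpace ℂ K] [CompleteSpace K]
    {A : H →ₗ.[ℂ] H} {Γ₀ Γ₁ : A.domain →ₗ[ℂ] K} {z s : ℂ} {T : K →L[ℂ] K}
    (W : WellPosed A Γ₀ Γ₁ z s T) (hs : s ≠ 0) (M : K →L[ℂ] K) :
    z ∈ pmapSpectrum (A.domRestrict
      ((LinearMap.eqLocus Γ₁ (M.toLinearMap ∘ₗ Γ₀)).map A.domain.subtype)) ↔
      (0 : ℂ) ∈ spectrum ℂ (T - s • M) := by
  obtain ⟨P, hP⟩ := W.poisson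
  obtain ⟨D, B, hD⟩ := W.dirichlet
  set A' := A.domRestrict ((LinearMap.eqLocus Γ₁ (M.toLinearMap ∘ₗ Γ₀)).map A.domain.subtype)
    with hA'
  have mem : ∀ x : A.domain, (x : H) ∈ A'.domain ↔ Γ₁ x = M (Γ₀ x) := by
    intro x
    rw [hA', LinearPMap.domRestrict_domain, Submodule.mem_inf]
    constructor
    · rintro ⟨⟨x', h, e⟩, -⟩
      have : x' = x := Subtype.ext e
      subst this
      exact h
    · intro h
      exact ⟨⟨x, h, rfl⟩, x.2⟩
  have val : ∀ (x : A.domain) (h : (x : H) ∈ A'.domain), A' ⟨x, h⟩ = A x := fun x h => rfl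
  have dom : ∀ x : A'.domain, (x : H) ∈ A.domain := fun x => x.2.2
  -- The difference of x and P(Γ₀ x) solves the homogeneous Dirichlet problem, hence vanishes.
  have key : ∀ x : A.domain, A x = z • (x : H) → s • Γ₁ x = T (Γ₀ x) ∧ (x : H) = P (Γ₀ x) := by
    intro x hx
    obtain ⟨h, h1, h2, h3⟩ := hP (Γ₀ x)
    have := W.unique (x - ⟨_, h⟩) (by rw [LinearPMap.map_sub, hx, h1]; simp [smul_sub])
      (by rw [map_sub, h2, sub_self])
    have e := sub_eq_zero.1 this
    refine ⟨?_, congrArg Subtype.val e⟩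
    rw [← h3, ← e]
  -- By the bounded inverse theorem on the complete space K, only bijectivity of T - sM is at stake.
  rw [spectrum.zero_mem_iff, ContinuousLinearMap.isUnit_iff_bijective, pmapSpectrum,
    Set.mem_ofPred_eq, not_iff_not]
  constructor
  · rintro ⟨R, hR1, hR2⟩
    constructor
    · rw [injective_iff_map_eq_zero]
      intro F hF
      obtain ⟨h, h1, h2, h3⟩ := hP F
      have hm : P F ∈ A'.domain := by
        refine (mem ⟨_, h⟩).2 (smul_right_injective K hs ?_)
        change s • Γ₁ _ = s • M _
        rw [h3, h2]
        exact sub_eq_zero.1 hF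
      have := hR2 ⟨_, hm⟩
      rw [val ⟨_, h⟩ hm, h1] at this
      simp only [sub_self, map_zero] at this
      rw [← h2]
      convert! Γ₀.map_zero
      exact this.symm
    · intro F
      -- With f = R(A - z)u, the vector f - u solves the homogeneous equation and has Γ₀(f - u) = Γ₀
      -- f. As Γ₁ f = MΓ₀ f, the chosen Γ₁ u makes sΓ₁(f - u) = TΓ₀(f - u) read sMΓ₀ f + F = TΓ₀ f.
      obtain ⟨u, hu0, hu1⟩ := W.surjective (-(s⁻¹ • F))
      obtain ⟨h, hR⟩ := hR1 (A u - z • (u : H))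
      set f : A.domain := ⟨_, dom ⟨_, h⟩⟩
      have hf := (mem f).1 h
      have hR' : A f - z • (f : H) = A u - z • (u : H) := hR
      obtain ⟨k1, -⟩ := key (f - u) (by
        rw [LinearPMap.map_sub, Submodule.coe_sub, smul_sub]
        exact sub_eq_sub_iff_sub_eq_sub.1 hR')
      refine ⟨Γ₀ f, ?_⟩
      rw [map_sub, map_sub, hu0, hu1, sub_zero, hf, sub_neg_eq_add, smul_add, smul_inv_smul₀ hs]
        at k1
      change T _ - s • M _ = F
      rw [← k1]; abel
  · intro hb
    obtain ⟨U, hU⟩ := ContinuousLinearMap.isUnit_iff_bijective.2 hb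
    have hLU : ∀ F, (T - s • M) ((U⁻¹ : (K →L[ℂ] K)ˣ).val F) = F := fun F => by
      rw [← hU, ← mul_apply_eq_comp, Units.mul_inv]; rfl
    set N : K →L[ℂ] K := (U⁻¹ : (K →L[ℂ] K)ˣ).val
    -- The Dirichlet solution D y violates the boundary condition by B y; adding P G with G = -sNBy
    -- repairs this, since (T - sM)NBy = By.
    let R : H →L[ℂ] H := D - s • (P ∘L N ∘L B)
    have hR : ∀ y, ∃ h : R y ∈ A'.domain, A' ⟨R y, h⟩ - z • R y = y := by
      intro y
      obtain ⟨h, h1, h2, h3⟩ := hD y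
      obtain ⟨g, g1, g2, g3⟩ := hP (N (B y))
      let x : A.domain := ⟨D y, h⟩ - s • ⟨P (N (B y)), g⟩
      have hx : (x : H) = R y := rfl
      have hA : A x - z • (x : H) = y := by
        simp only [x, LinearPMap.map_sub, LinearPMap.map_smul, h1, g1, Submodule.coe_sub,
          Submodule.coe_smul]
        module
      have hm : (x : H) ∈ A'.domain := by
        refine (mem x).2 ?_
        simp only [x, map_sub, map_smul, h2, h3, g2, g3]
        have := hLU (B y)
        change T (N (B y)) - s • M (N (B y)) = B y at this
        rw [sub_eq_iff_eq_add.1 this, map_zero]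
        abel
      exact ⟨hm, hA⟩
    refine ⟨R, hR, fun x => ?_⟩
    obtain ⟨h, e⟩ := hR (A' x - z • (x : H))
    set y := R (A' x - z • (x : H))
    -- Both vectors satisfy the boundary condition and have the same image under A - z, so (T -
    -- sM)Γ₀ d = 0; hence Γ₀ d = 0 and d = P 0 = 0.
    let d : A.domain := ⟨y, dom ⟨_, h⟩⟩ - ⟨x, dom x⟩
    have hd : A d = z • (d : H) := by
      simp only [d, LinearPMap.map_sub, Submodule.coe_sub, smul_sub]
      exact sub_eq_sub_iff_sub_eq_sub.1 e
    have hdm : Γ₁ d = M (Γ₀ d) := (mem d).1 (A'.domain.sub_mem h x.2)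
    obtain ⟨k1, k2⟩ := key d hd
    rw [hdm] at k1
    have h0 : Γ₀ d = 0 := (injective_iff_map_eq_zero (T - s • M)).1 hb.1 _ (by
      change T _ - s • M _ = 0
      rw [← k1, sub_self])
    rw [h0, map_zero] at k2
    exact sub_eq_zero.1 k2

/-! ### Functions on an edge and their derivatives -/

/-- The integral over `[0, x]`. -/
def edgeIntegral (x : Set.Icc (0 : ℝ) 1) : EdgeL2 →L[ℂ] ℂ :=
  LinearMap.mkContinuous
    { toFun := fun g => ∫ t in (0 : ℝ)..x, g t
      map_add' := fun g h => intervalIntegral_add_edge g h x.2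
      map_smul' := fun a g => intervalIntegral_smul_edge a g x.2 } 1
    fun g => by simpa using norm_intervalIntegral_edge_le g x.2

theorem edgeIntegral_apply (x : Set.Icc (0 : ℝ) 1) (g : EdgeL2) :
    edgeIntegral x g = ∫ t in (0 : ℝ)..x, g t := rfl

theorem edge_memLp_of_continuous {v : ℝ → ℂ} (hv : ContinuousOn v (Set.Icc 0 1))
    {p : ENNReal} : MemLp v p edgeMeasure := by
  obtain ⟨C, hC⟩ := isCompact_Icc.exists_bound_of_continuousOn hv
  refine MemLp.of_bound (hv.aestronglyMeasurable measurableSet_Icc) C ?_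
  filter_upwards [edge_ae_mem] with x hx using hC x hx

theorem continuousOn_primitive_edge (g : EdgeL2) :
    ContinuousOn (fun x => ∫ t in (0 : ℝ)..x, g t) (Set.Icc (0 : ℝ) 1) := by
  have := intervalIntegral.continuousOn_primitive_interval'
    (intervalIntegrable_edge g (x := 1) (by simp)) (a := (0 : ℝ)) Set.left_mem_uIcc
  rwa [Set.uIcc_of_le zero_le_one] at this

/-- The primitive vanishing at `0`. -/
def edgePrimitive : EdgeL2 →L[ℂ] EdgeL2 :=
  LinearMap.mkContinuous
    { toFun := fun g => (edge_memLp_of_continuous (continuousOn_primitive_edge g)).toLp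
      map_add' := fun g h => by
        rw [← MemLp.toLp_add]
        refine MemLp.toLp_congr _ _ ?_
        filter_upwards [edge_ae_mem] with x hx using intervalIntegral_add_edge g h hx
      map_smul' := fun a g => by
        rw [RingHom.id_apply, ← MemLp.toLp_const_smul]
        refine MemLp.toLp_congr _ _ ?_
        filter_upwards [edge_ae_mem] with x hx using intervalIntegral_smul_edge a g hx } 1
    fun g => by
      refine (Lp.norm_le_of_ae_bound (norm_nonneg g) (?_ : ∀ᵐ x ∂edgeMeasure, _ ≤ ‖g‖)).trans ?_
      · filter_upwards [edge_ae_mem,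
          (edge_memLp_of_continuous (continuousOn_primitive_edge g) (p := 2)).coeFn_toLp]
          with x hx e
        exact (congrArg norm e).trans_le (norm_intervalIntegral_edge_le g hx)
      · simp [measureUnivNNReal]

theorem edgePrimitive_apply (g : EdgeL2) :
    ∀ᵐ x ∂edgeMeasure, edgePrimitive g x = ∫ t in (0 : ℝ)..x, g t :=
  (edge_memLp_of_continuous (continuousOn_primitive_edge g) (p := 2)).coeFn_toLp

/-- Multiplication by a continuous function. -/
def edgeMul (φ : C(ℝ, ℂ)) : EdgeL2 →L[ℂ] EdgeL2 :=
  (ContinuousLinearMap.mul ℂ ℂ).holderL edgeMeasure ⊤ 2 2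
    (edge_memLp_of_continuous φ.continuous.continuousOn).toLp

theorem edgeMul_apply (φ : C(ℝ, ℂ)) (f : EdgeL2) :
    ∀ᵐ x ∂edgeMeasure, edgeMul φ f x = φ x * f x := by
  filter_upwards [(ContinuousLinearMap.mul ℂ ℂ).coeFn_holder (r := 2)
    (edge_memLp_of_continuous φ.continuous.continuousOn (p := ⊤)).toLp f,
    (edge_memLp_of_continuous φ.continuous.continuousOn (p := ⊤)).coeFn_toLp] with x h h'
  refine h.trans ?_
  rw [h']
  rfl

theorem edgeMul_const (a : ℂ) (f : EdgeL2) : edgeMul (.const ℝ a) f = a • f := by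
  refine Lp.ext ?_
  filter_upwards [edgeMul_apply (.const ℝ a) f, Lp.coeFn_smul a f] with x h1 h2
  rw [h1, h2]; rfl

theorem edgeMul_mul (φ ψ : C(ℝ, ℂ)) (f : EdgeL2) :
    edgeMul (φ * ψ) f = edgeMul φ (edgeMul ψ f) := by
  refine Lp.ext ?_
  filter_upwards [edgeMul_apply (φ * ψ) f, edgeMul_apply φ (edgeMul ψ f), edgeMul_apply ψ f]
    with x h1 h2 h3
  rw [h1, h2, h3, ContinuousMap.mul_apply, mul_assoc]

theorem edgeMul_smul (a : ℂ) (φ : C(ℝ, ℂ)) (f : EdgeL2) :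
    edgeMul (a • φ) f = a • edgeMul φ f := by
  rw [← edgeMul_const, ← edgeMul_mul]
  rfl

theorem edgeMul_comm (φ ψ : C(ℝ, ℂ)) (f : EdgeL2) :
    edgeMul φ (edgeMul ψ f) = edgeMul ψ (edgeMul φ f) := by
  rw [← edgeMul_mul, mul_comm, edgeMul_mul]

theorem edgeMul_add (φ ψ : C(ℝ, ℂ)) (f : EdgeL2) :
    edgeMul (φ + ψ) f = edgeMul φ f + edgeMul ψ f := by
  refine Lp.ext ?_
  filter_upwards [edgeMul_apply (φ + ψ) f, edgeMul_apply φ f, edgeMul_apply ψ f,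
    Lp.coeFn_add (edgeMul φ f) (edgeMul ψ f)] with x h1 h2 h3 h4
  rw [h1, h4, Pi.add_apply, h2, h3, ContinuousMap.add_apply, add_mul]

/-- Both sides are bounded linear functionals of g, so it suffices to take g in the dense set of
bounded continuous functions. There the primitive is C¹ and classical integration of a product
derivative applies. -/
theorem product_rule_edge {φ φ' : C(ℝ, ℂ)} (hφ : ∀ x, HasDerivAt φ (φ' x) x)
    (x : Set.Icc (0 : ℝ) 1) (g : EdgeL2) :
    φ x * edgeIntegral x g =
      edgeIntegral x (edgeMul φ' (edgePrimitive g) + edgeMul φ g) := by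
  let Φ : EdgeL2 →L[ℂ] ℂ := edgeIntegral x ∘L (edgeMul φ' ∘L edgePrimitive + edgeMul φ)
  suffices h : (fun g => φ x * edgeIntegral x g) = Φ from congrFun h g
  refine (BoundedContinuousFunction.toLp_denseRange ℂ edgeMeasure ℂ (p := 2)
    (by simp)).equalizer (continuous_const.mul (edgeIntegral x).continuous) Φ.continuous ?_
  funext g
  set G : EdgeL2 := BoundedContinuousFunction.toLp 2 edgeMeasure ℂ g
  have hG : G =ᵐ[edgeMeasure] g := BoundedContinuousFunction.coeFn_toLp _ _ ℂ g
  have e1 : ∀ y ∈ Set.Icc (0 : ℝ) 1, ∫ t in (0 : ℝ)..y, G t = ∫ t in (0 : ℝ)..y, g t :=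
    fun y hy => intervalIntegral_congr_edge hG hy
  have e2 : (edgeMul φ' (edgePrimitive G) + edgeMul φ G : EdgeL2) =ᵐ[edgeMeasure]
      fun y => φ' y * (∫ t in (0 : ℝ)..y, g t) + φ y * g y := by
    filter_upwards [hG, edgePrimitive_apply G, edgeMul_apply φ G,
      edgeMul_apply φ' (edgePrimitive G), Lp.coeFn_add (edgeMul φ' (edgePrimitive G))
      (edgeMul φ G), edge_ae_mem] with y h1 h2 h3 h4 h5 hy
    rw [h5, Pi.add_apply, h4, h3, h2, h1, e1 y hy]
  change φ x * edgeIntegral x G =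
    edgeIntegral x (edgeMul φ' (edgePrimitive G) + edgeMul φ G)
  rw [edgeIntegral_apply, edgeIntegral_apply, e1 x x.2, intervalIntegral_congr_edge e2 x.2,
    intervalIntegral.integral_deriv_mul_eq_sub (v := fun y => ∫ t in (0 : ℝ)..y, g t)
      (fun y _ => hφ y) (fun y _ => g.continuous.integral_hasStrictDerivAt 0 y |>.hasDerivAt)
      (φ'.continuous.intervalIntegrable _ _) (g.continuous.intervalIntegrable _ _)]
  simp

theorem fundamental_thm_edge {φ φ' : C(ℝ, ℂ)} (hφ : ∀ x, HasDerivAt φ (φ' x) x) (x : ℝ) :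
    φ x = φ 0 + ∫ t in (0 : ℝ)..x, φ' t := by
  rw [intervalIntegral.integral_eq_sub_of_hasDerivAt (fun y _ => hφ y)
    (φ'.continuous.intervalIntegrable _ _)]
  ring

/-- The constant function `1`. -/
def edgeOne : EdgeL2 := Lp.const 2 edgeMeasure 1

theorem edgeOne_apply : ∀ᵐ x ∂edgeMeasure, edgeOne x = 1 := by
  filter_upwards [Lp.coeFn_const (p := 2) (μ := edgeMeasure) (1 : ℂ)] with x h using h

/-- This replaces the almost-everywhere formula by an identity in L², to which bounded operators can
be applied. -/
theorem isPrimitive_iff {f g : EdgeL2} {c : ℂ} :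
    IsPrimitive f c g ↔ f = c • edgeOne + edgePrimitive g := by
  have h : ∀ᵐ x ∂edgeMeasure, (c • edgeOne + edgePrimitive g : EdgeL2) x =
      c + ∫ t in (0 : ℝ)..x, g t := by
    filter_upwards [Lp.coeFn_add (c • edgeOne) (edgePrimitive g), Lp.coeFn_smul c edgeOne,
      edgeOne_apply, edgePrimitive_apply g] with x h1 h2 h3 h4
    rw [h1, Pi.add_apply, h2, Pi.smul_apply, h3, h4, smul_eq_mul, mul_one]
  constructor
  · intro hp
    refine Lp.ext ?_
    filter_upwards [hp, h] with x h1 h2 using h1.trans h2.symm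
  · rintro rfl
    exact h

/-- `f` is in `H¹(I)`, with `f(0) = a`, `f(1) = b` and derivative `g`. -/
structure HasEdgeData (f : EdgeL2) (a b : ℂ) (g : EdgeL2) : Prop where
  isPrimitive : IsPrimitive f a g
  eval_one : b = a + ∫ t in (0 : ℝ)..1, g t

namespace HasEdgeData

variable {f f₁ f₂ g g₁ g₂ : EdgeL2} {a a₁ a₂ b b₁ b₂ : ℂ}

theorem add (h₁ : HasEdgeData f₁ a₁ b₁ g₁) (h₂ : HasEdgeData f₂ a₂ b₂ g₂) :
    HasEdgeData (f₁ + f₂) (a₁ + a₂) (b₁ + b₂) (g₁ + g₂) := by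
  refine ⟨h₁.1.add h₂.1, ?_⟩
  rw [intervalIntegral_add_edge _ _ (by simp), h₁.2, h₂.2]
  ring

theorem smul (k : ℂ) (h : HasEdgeData f a b g) :
    HasEdgeData (k • f) (k * a) (k * b) (k • g) := by
  refine ⟨h.1.smul k, ?_⟩
  rw [intervalIntegral_smul_edge _ _ (by simp), h.2]
  ring

theorem primitive (g : EdgeL2) :
    HasEdgeData (edgePrimitive g) 0 (edgeIntegral ⟨1, by simp⟩ g) g :=
  ⟨isPrimitive_iff.2 (by simp), by rw [zero_add]; rfl⟩

theorem ofContinuous {φ φ' : C(ℝ, ℂ)} (hφ : ∀ x, HasDerivAt φ (φ' x) x) :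
    HasEdgeData (edgeMul φ edgeOne) (φ 0) (φ 1) (edgeMul φ' edgeOne) := by
  have h : ∀ ψ : C(ℝ, ℂ), edgeMul ψ edgeOne =ᵐ[edgeMeasure] ψ := fun ψ => by
    filter_upwards [edgeMul_apply ψ edgeOne, edgeOne_apply] with x h1 h2
    rw [h1, h2, mul_one]
  constructor
  · filter_upwards [h φ, edge_ae_mem] with x h1 hx
    rw [h1, intervalIntegral_congr_edge (h φ') hx]
    exact fundamental_thm_edge hφ x
  · rw [intervalIntegral_congr_edge (h φ') (by simp)]
    exact fundamental_thm_edge hφ 1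

/-- Split f into a constant and a primitive vanishing at 0: `ofContinuous` treats the first summand,
`product_rule_edge` the second. -/
theorem mul {φ φ' : C(ℝ, ℂ)} (hφ : ∀ x, HasDerivAt φ (φ' x) x) (h : HasEdgeData f a b g) :
    HasEdgeData (edgeMul φ f) (φ 0 * a) (φ 1 * b) (edgeMul φ' f + edgeMul φ g) := by
  have hp : HasEdgeData (edgeMul φ (edgePrimitive g)) 0 (φ 1 * edgeIntegral ⟨1, by simp⟩ g)
      (edgeMul φ' (edgePrimitive g) + edgeMul φ g) := by
    constructor
    · filter_upwards [edgeMul_apply φ (edgePrimitive g), edgePrimitive_apply g, edge_ae_mem]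
        with x h1 h2 hx
      rw [h1, h2, zero_add]
      exact product_rule_edge hφ ⟨x, hx⟩ g
    · rw [zero_add]
      exact product_rule_edge hφ ⟨1, by simp⟩ g
  convert ((ofContinuous hφ).smul a).add hp using 1
  · rw [isPrimitive_iff.1 h.1, map_add, map_smul]
  · ring
  · rw [h.2, edgeIntegral_apply]; ring
  · rw [isPrimitive_iff.1 h.1, map_add, map_smul, add_assoc]

theorem unique (h₁ : HasEdgeData f a₁ b₁ g₁) (h₂ : HasEdgeData f a₂ b₂ g₂) :
    a₁ = a₂ ∧ b₁ = b₂ ∧ g₁ = g₂ := by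
  obtain ⟨rfl, rfl⟩ := h₁.1.unique h₂.1
  exact ⟨rfl, h₁.2.trans h₂.2.symm, rfl⟩

theorem mem (h : HasEdgeData f a b g) : f ∈ EdgeH1 := ⟨a, g, h.1⟩

theorem edgeDeriv_eq (h : HasEdgeData f a b g) (hf : f ∈ EdgeH1) : edgeDeriv ⟨f, hf⟩ = g :=
  ((edgeData_spec ⟨f, hf⟩).unique h.1).2

theorem edgeEval_eq (h : HasEdgeData f a b g) (hf : f ∈ EdgeH1) (s : Bool) :
    edgeEval s ⟨f, hf⟩ = if s then b else a := by
  have h0 := ((edgeData_spec ⟨f, hf⟩).unique h.1).1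
  cases s
  · simpa [edgeEval] using h0
  · simp only [edgeEval, LinearMap.coe_mk, AddHom.coe_mk, if_true]
    rw [h0, h.edgeDeriv_eq hf, h.2]

theorem of_mem (hf : f ∈ EdgeH1) :
    HasEdgeData f (edgeEval false ⟨f, hf⟩) (edgeEval true ⟨f, hf⟩) (edgeDeriv ⟨f, hf⟩) := by
  constructor
  · have : edgeEval false ⟨f, hf⟩ = (edgeData ⟨f, hf⟩).1 := by simp [edgeEval]
    rw [this]
    exact edgeData_spec ⟨f, hf⟩
  · simp [edgeEval]

theorem eq_smul_edgeOne (h : HasEdgeData f a b 0) : f = a • edgeOne := by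
  simpa using isPrimitive_iff.1 h.1

end HasEdgeData

/-! ### The equation `-f'' = μ f + y` on an edge -/

/-- The solutions `C`, `S` of `-f'' = μ f` with `C(0) = S'(0) = 1` and `C'(0) = S(0) = 0`. -/
structure FundamentalSystem (μ : ℂ) (C S : C(ℝ, ℂ)) : Prop where
  deriv_cos : ∀ x, HasDerivAt C (((-μ) • S) x) x
  deriv_sin : ∀ x, HasDerivAt S (C x) x
  cos_zero : C 0 = 1
  sin_zero : S 0 = 0
  sq_add : ∀ x, C x * C x + μ * (S x * S x) = 1

theorem exists_fundamentalSystem (w : ℂ) : ∃ C S : C(ℝ, ℂ), FundamentalSystem (w ^ 2) C S ∧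
    C 1 = Complex.cos w ∧ S 1 = csinc w := by
  have hw : ∀ x : ℝ, HasDerivAt (fun x : ℝ => w * (x : ℂ)) w x := fun x => by
    simpa using (Complex.ofRealCLM.hasDerivAt (x := x)).const_mul w
  -- The value x at w = 0 is the limit of sin(wx)/w, so μ = 0 needs no separate treatment later.
  let S : ℝ → ℂ := fun x => if w = 0 then (x : ℂ) else Complex.sin (w * x) / w
  have hC : ∀ x : ℝ, HasDerivAt (fun x : ℝ => Complex.cos (w * x)) (-(w ^ 2) * S x) x := by
    intro x
    convert! (Complex.hasDerivAt_cos _).comp x (hw x) using 1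
    by_cases h : w = 0
    · simp [h]
    · simp only [S, h, if_false]; field_simp
  have hS : ∀ x : ℝ, HasDerivAt S (Complex.cos (w * x)) x := by
    intro x
    by_cases h : w = 0
    · simp only [S, h, if_true, zero_mul, Complex.cos_zero]
      exact Complex.ofRealCLM.hasDerivAt (x := x)
    · simp only [S, h, if_false]
      convert! ((Complex.hasDerivAt_sin _).comp x (hw x)).div_const w using 1
      field_simp
  refine ⟨⟨fun x => Complex.cos (w * x), by fun_prop⟩,
    ⟨S, continuous_iff_continuousAt.2 fun x => (hS x).continuousAt⟩,
    ⟨hC, hS, by simp, by simp [S], fun x => ?_⟩, by simp, by simp [S, csinc]⟩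
  simp only [ContinuousMap.coe_mk]
  have := Complex.sin_sq_add_cos_sq (w * x)
  by_cases h : w = 0
  · simp [h]
  · simp only [S, h, if_false]
    field_simp
    linear_combination this

namespace FundamentalSystem

variable {μ : ℂ} {C S : C(ℝ, ℂ)}

theorem edgeMul_sq_add (h : FundamentalSystem μ C S) (f : EdgeL2) :
    edgeMul C (edgeMul C f) + μ • edgeMul S (edgeMul S f) = f := by
  have : C * C + .const ℝ μ * (S * S) = .const ℝ 1 := ContinuousMap.ext h.sq_add
  rw [← edgeMul_mul, ← edgeMul_mul, ← edgeMul_const, ← edgeMul_mul, ← edgeMul_add, this,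
    edgeMul_const, one_smul]

theorem hasEdgeData_cos (h : FundamentalSystem μ C S) :
    HasEdgeData (edgeMul C edgeOne) 1 (C 1) (-(μ • edgeMul S edgeOne)) := by
  have := HasEdgeData.ofContinuous h.deriv_cos
  rwa [edgeMul_smul, neg_smul, h.cos_zero] at this

theorem hasEdgeData_sin (h : FundamentalSystem μ C S) :
    HasEdgeData (edgeMul S edgeOne) 0 (S 1) (edgeMul C edgeOne) := by
  have := HasEdgeData.ofContinuous h.deriv_sin
  rwa [h.sin_zero] at this

theorem mul_cos (h : FundamentalSystem μ C S) {f g : EdgeL2} {a b : ℂ}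
    (hf : HasEdgeData f a b g) :
    HasEdgeData (edgeMul C f) a (C 1 * b) (-(μ • edgeMul S f) + edgeMul C g) := by
  have := hf.mul h.deriv_cos
  rwa [edgeMul_smul, neg_smul, h.cos_zero, one_mul] at this

theorem mul_sin (h : FundamentalSystem μ C S) {f g : EdgeL2} {a b : ℂ}
    (hf : HasEdgeData f a b g) :
    HasEdgeData (edgeMul S f) 0 (S 1 * b) (edgeMul C f + edgeMul S g) := by
  have := hf.mul h.deriv_sin
  rwa [h.sin_zero, zero_mul] at this

/-- With g = f', both Cf - Sg and μSf + Cg have derivative zero, so they are the constants a and a'.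
Multiplying by C and S and adding recovers f because C² + μS² = 1. -/
theorem eq_of_ode (h : FundamentalSystem μ C S) {f g : EdgeL2} {a b a' b' : ℂ}
    (hf : HasEdgeData f a b g) (hg : HasEdgeData g a' b' (-(μ • f))) :
    f = a • edgeMul C edgeOne + a' • edgeMul S edgeOne := by
  have h1 := (h.mul_cos hf).add ((h.mul_sin hg).smul (-1))
  have h2 := ((h.mul_sin hf).smul μ).add (h.mul_cos hg)
  have e1 : -(μ • edgeMul S f) + edgeMul C g +
      (-1 : ℂ) • (edgeMul C g + edgeMul S (-(μ • f))) = 0 := by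
    rw [map_neg, map_smul]; module
  have e2 : μ • (edgeMul C f + edgeMul S g) +
      (-(μ • edgeMul S g) + edgeMul C (-(μ • f))) = 0 := by
    rw [map_neg, map_smul]; module
  rw [e1] at h1
  rw [e2] at h2
  have h1 := congrArg (edgeMul C) h1.eq_smul_edgeOne
  have h2 := congrArg (edgeMul S) h2.eq_smul_edgeOne
  simp only [map_add, map_smul, mul_zero, add_zero, zero_add] at h1 h2
  rw [← h1, ← h2, edgeMul_comm C S]
  conv_lhs => rw [← h.edgeMul_sq_add f]
  module

theorem dirichlet_unique (h : FundamentalSystem μ C S) (hs : S 1 ≠ 0) {f g : EdgeL2}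
    {a' b' : ℂ} (hf : HasEdgeData f 0 0 g) (hg : HasEdgeData g a' b' (-(μ • f))) : f = 0 := by
  have e := h.eq_of_ode hf hg
  rw [zero_smul, zero_add] at e
  rw [e] at hf
  have := (hf.unique (h.hasEdgeData_sin.smul a')).2.1
  rw [e, (mul_eq_zero.1 this.symm).resolve_right hs, zero_smul]

/-- Variation of constants: f = C∫Sy - S∫Cy + kS solves -f'' = μf + y with f(0) = 0 and f'(0) = k.
The number k is chosen so that f(1) = 0, which is possible as S(1) ≠ 0. -/
theorem exists_dirichlet (h : FundamentalSystem μ C S) (hs : S 1 ≠ 0) :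
    ∃ (D D' : EdgeL2 →L[ℂ] EdgeL2) (β : Bool → EdgeL2 →L[ℂ] ℂ), ∀ y,
      HasEdgeData (D y) 0 0 (D' y) ∧
      HasEdgeData (D' y) (β false y) (β true y) (-y + -(μ • D y)) := by
  let I : EdgeL2 →L[ℂ] ℂ := edgeIntegral ⟨1, by simp⟩
  let k : EdgeL2 →L[ℂ] ℂ := I ∘L edgeMul C - (C 1 / S 1) • (I ∘L edgeMul S)
  let K : EdgeL2 →L[ℂ] EdgeL2 := k.smulRight edgeOne
  let JC : EdgeL2 →L[ℂ] EdgeL2 := edgePrimitive ∘L edgeMul C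
  let JS : EdgeL2 →L[ℂ] EdgeL2 := edgePrimitive ∘L edgeMul S
  refine ⟨edgeMul C ∘L JS - edgeMul S ∘L JC + edgeMul S ∘L K,
    -(edgeMul C ∘L JC) - μ • (edgeMul S ∘L JS) + edgeMul C ∘L K,
    fun b => if b then C 1 • (k - I ∘L edgeMul C) - (μ * S 1) • (I ∘L edgeMul S) else k,
    fun y => ?_⟩
  have pC := HasEdgeData.primitive (edgeMul C y)
  have pS := HasEdgeData.primitive (edgeMul S y)
  constructor
  · convert! ((h.mul_cos pS).add ((h.mul_sin pC).smul (-1))).add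
      (h.hasEdgeData_sin.smul (k y)) using 1
    · simp [JS, JC, K]; module
    · ring
    · simp only [k, I, sub_apply, smul_apply,
        ContinuousLinearMap.comp_apply, smul_eq_mul]
      field_simp
      ring
    · simp only [JS, JC, K, sub_apply, smul_apply,
        ContinuousLinearMap.comp_apply, add_apply,
        neg_apply, ContinuousLinearMap.smulRight_apply, map_smul,
        edgeMul_comm C S]
      module
  · convert! (((h.mul_cos pC).smul (-1)).add ((h.mul_sin pS).smul (-μ))).add
      (h.hasEdgeData_cos.smul (k y)) using 1
    · simp [JS, JC, K]; module
    · simp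
    · simp [I]; ring
    · simp only [JS, JC, K, sub_apply, ContinuousLinearMap.comp_apply, add_apply, ContinuousLinearMap.smulRight_apply, map_smul]
      conv_lhs => enter [1]; rw [← h.edgeMul_sq_add y]
      module

/-- The solutions are ψ = C - (C(1)/S(1))S and φ = S/S(1). The identity C² + μS² = 1 at 1 simplifies
ψ'(1) to -1/S(1). -/
theorem exists_poisson (h : FundamentalSystem μ C S) (hs : S 1 ≠ 0) :
    ∃ ψ ψ' φ φ' : EdgeL2,
      HasEdgeData ψ 1 0 ψ' ∧ HasEdgeData ψ' (-(C 1 / S 1)) (-(S 1)⁻¹) (-(μ • ψ)) ∧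
      HasEdgeData φ 0 1 φ' ∧ HasEdgeData φ' (S 1)⁻¹ (C 1 / S 1) (-(μ • φ)) := by
  refine ⟨edgeMul C edgeOne + (-(C 1 / S 1)) • edgeMul S edgeOne,
    (-μ) • edgeMul S edgeOne + (-(C 1 / S 1)) • edgeMul C edgeOne,
    (S 1)⁻¹ • edgeMul S edgeOne, (S 1)⁻¹ • edgeMul C edgeOne, ?_, ?_, ?_, ?_⟩
  · convert! h.hasEdgeData_cos.add (h.hasEdgeData_sin.smul (-(C 1 / S 1))) using 1
    · ring
    · field_simp; ring
    · module
  · convert! (h.hasEdgeData_sin.smul (-μ)).add (h.hasEdgeData_cos.smul (-(C 1 / S 1))) using 1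
    · ring
    · field_simp; linear_combination h.sq_add 1
    · module
  · convert! h.hasEdgeData_sin.smul (S 1)⁻¹ using 1
    · ring
    · exact (inv_mul_cancel₀ hs).symm
  · convert! h.hasEdgeData_cos.smul (S 1)⁻¹ using 1
    · ring
    · ring
    · module

end FundamentalSystem

/-- These Hermite cubics, x - 2x² + x³ and x³ - x², prescribe the end point derivatives while
keeping the end point values zero; they give the surjectivity of Γ₁ on ker Γ₀. -/
theorem exists_edge_neumann :
    ∃ p p' p'' q q' q'' : EdgeL2, HasEdgeData p 0 0 p' ∧ HasEdgeData p' 1 0 p'' ∧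
      HasEdgeData q 0 0 q' ∧ HasEdgeData q' 0 1 q'' := by
  let u : C(ℝ, ℂ) := ⟨fun x => x, by fun_prop⟩
  have hu : ∀ x : ℝ, HasDerivAt (fun x : ℝ => (x : ℂ)) 1 x :=
    fun x => Complex.ofRealCLM.hasDerivAt (x := x)
  let k : ℂ → C(ℝ, ℂ) := fun a => .const ℝ a
  have key : ∀ a b c : ℂ, ∃ p p' p'' : EdgeL2, HasEdgeData p 0 (a + b + c) p' ∧
      HasEdgeData p' a (a + 2 * b + 3 * c) p'' := by
    intro a b c
    let φ : C(ℝ, ℂ) := k a * u + k b * u ^ 2 + k c * u ^ 3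
    let φ' : C(ℝ, ℂ) := k a + k (2 * b) * u + k (3 * c) * u ^ 2
    let φ'' : C(ℝ, ℂ) := k (2 * b) + k (6 * c) * u
    have h1 : ∀ x, HasDerivAt φ (φ' x) x := fun x => by
      convert! (((hu x).const_mul a).add (((hu x).pow 2).const_mul b)).add
        (((hu x).pow 3).const_mul c) using 1
      simp [φ', k, u]
      ring
    have h2 : ∀ x, HasDerivAt φ' (φ'' x) x := fun x => by
      convert! (((hu x).const_mul (2 * b)).const_add a).add
        (((hu x).pow 2).const_mul (3 * c)) using 1
      simp [φ'', k, u]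
      ring
    have d1 := HasEdgeData.ofContinuous h1
    have d2 := HasEdgeData.ofContinuous h2
    rw [show φ 0 = 0 by simp [φ, k, u], show φ 1 = a + b + c by simp [φ, k, u]] at d1
    rw [show φ' 0 = a by simp [φ', k, u],
      show φ' 1 = a + 2 * b + 3 * c by simp [φ', k, u]] at d2
    exact ⟨_, _, _, d1, d2⟩
  obtain ⟨p, p', p'', h1, h2⟩ := key 1 (-2) 1
  obtain ⟨q, q', q'', h3, h4⟩ := key 0 (-1) 1
  norm_num at h1 h2 h3 h4
  exact ⟨p, p', p'', q, q', q'', h1, h2, h3, h4⟩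

/-! ### Operators on `L²(X)` that act edgewise -/

theorem memlp_map {E A B : Type*} [NormedAddCommGroup A] [NormedSpace ℂ A]
    [NormedAddCommGroup B] [NormedSpace ℂ B] (T : A →L[ℂ] B) (f : lp (fun _ : E => A) 2) :
    Memℓp (fun e : E => T (f e)) 2 := by
  refine ((lp.memℓp f).norm.const_smul ‖T‖).mono fun e => ?_
  exact T.le_opNorm (f e)

/-- The diagonal operator on `ℓ²(E, A)` given by `T : A → B`. -/
def lpMap (E : Type*) {A B : Type*} [NormedAddCommGroup A] [NormedSpace ℂ A]
    [NormedAddCommGroup B] [NormedSpace ℂ B] (T : A →L[ℂ] B) :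
    lp (fun _ : E => A) 2 →L[ℂ] lp (fun _ : E => B) 2 :=
  LinearMap.mkContinuous
    { toFun := fun f => ⟨fun e => T (f e), memlp_map T f⟩
      map_add' := fun f g => lp.ext (funext fun e => T.map_add (f e) (g e))
      map_smul' := fun a f => lp.ext (funext fun e => T.map_smul a (f e)) } ‖T‖
    fun f => by
      have h : ‖((‖T‖ : ℂ) • f : lp (fun _ : E => A) 2)‖ = ‖T‖ * ‖f‖ := by
        rw [norm_smul, Complex.norm_real, norm_norm]
      rw [← h]
      refine lp.norm_mono two_ne_zero fun e => ?_
      rw [lp.coeFn_smul, Pi.smul_apply, norm_smul, Complex.norm_real, norm_norm]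
      exact T.le_opNorm (f e)

namespace EdgeGraph

variable {V E : Type*} (X : EdgeGraph V E)

theorem inc_side_edge (i : X.Incidence) : X.inc i.side i.edge = i := by
  obtain ⟨v, ⟨⟨e, b⟩, h⟩⟩ := i
  dsimp only at h
  subst h
  rfl

theorem pull_apply (b : Bool) (F : X.GMax) (e : E) : X.pull b F e = F (X.inc b e) := rfl

open ContinuousLinearMap in
-- The adjoint of a restriction to one side is extension by zero to the other; coordinates are read
-- off by pairing with unit vectors.
theorem adjoint_pull_apply (b : Bool) (ω : X.EdgeForms) (i : X.Incidence) :
    adjoint (X.pull b) ω i = if i.side = b then ω i.edge else 0 := by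
  classical
  have h := lp.inner_single_left (𝕜 := ℂ) i (1 : ℂ) (adjoint (X.pull b) ω)
  have h' : X.pull b (lp.single 2 i 1) = if i.side = b then lp.single 2 i.edge 1 else 0 := by
    refine lp.ext (funext fun e => ?_)
    rw [pull_apply, lp.single_apply]
    by_cases hb : i.side = b
    · rw [if_pos hb, lp.single_apply]
      have : X.inc b e = i ↔ e = i.edge := by
        rw [← hb]
        conv_lhs => rhs; rw [← X.inc_side_edge i]
        exact (X.inc_injective _).eq_iff
      simp [Pi.single_apply, this]
    · rw [if_neg hb, Pi.single_eq_of_ne]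
      · rfl
      · rintro rfl
        exact hb rfl
  rw [adjoint_inner_right, h'] at h
  simp only [RCLike.inner_apply, map_one, mul_one] at h
  rw [← h]
  split_ifs
  · rw [lp.inner_single_left]; simp
  · simp

/-- The family in `𝒢^max` with the values `a e` at `∂₋ e` and `b e` at `∂₊ e`. -/
def glue (a b : X.EdgeForms) : X.GMax :=
  ContinuousLinearMap.adjoint (X.pull false) a + ContinuousLinearMap.adjoint (X.pull true) b

theorem glue_apply (a b : X.EdgeForms) (i : X.Incidence) :
    X.glue a b i = if i.side then b i.edge else a i.edge := by
  rw [glue, lp.coeFn_add, Pi.add_apply, adjoint_pull_apply, adjoint_pull_apply]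
  cases i.side <;> simp

theorem glue_pull (F : X.GMax) : X.glue (X.pull false F) (X.pull true F) = F := by
  refine lp.ext (funext fun i => ?_)
  rw [glue_apply]
  conv_rhs => rw [← X.inc_side_edge i]
  cases i.side <;> rfl

variable (G : Submodule ℂ X.GMax)

/-- The adjoint of the inclusion of 𝒢 is the projection, so Δ_𝒢 is a compression to 𝒢 of an operator
acting edge by edge. This is the form in which the normal derivatives appear. -/
theorem discreteLaplacian_apply [CompleteSpace G] (F : G) :
    X.discreteLaplacian G F = G.orthogonalProjectionOnto
      (X.glue (X.pull false F - X.pull true F) (X.pull true F - X.pull false F)) := by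
  rw [discreteLaplacian, extDeriv, ContinuousLinearMap.adjoint_comp, Submodule.adjoint_subtypeL]
  simp only [ContinuousLinearMap.comp_apply, Submodule.subtypeL_apply, map_sub, map_add, sub_apply, glue]
  abel

/-- `f` is in `H¹_max(X)`, with the values `a` at the initial vertices, `b` at the terminal
vertices and derivative `g`. -/
def HasGraphData (f : X.L2) (a b : X.EdgeForms) (g : X.L2) : Prop :=
  ∀ e, HasEdgeData (f e) (a e) (b e) (g e)

variable {X}

theorem hasGraphData_H1Max (f : X.H1Max) :
    X.HasGraphData f (X.pull false (X.trace f)) (X.pull true (X.trace f)) (X.deriv f) :=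
  fun e => HasEdgeData.of_mem (f.2.1 e)

namespace HasGraphData

variable {f g : X.L2} {a b : X.EdgeForms}

theorem mem (h : X.HasGraphData f a b g) : f ∈ X.H1Max := by
  refine ⟨fun e => (h e).mem, ?_⟩
  convert lp.memℓp g using 1
  exact funext fun e => (h e).edgeDeriv_eq _

theorem deriv_eq (h : X.HasGraphData f a b g) (hf : f ∈ X.H1Max) : X.deriv ⟨f, hf⟩ = g :=
  lp.ext (funext fun e => (h e).edgeDeriv_eq _)

theorem trace_eq (h : X.HasGraphData f a b g) (hf : f ∈ X.H1Max) :
    X.trace ⟨f, hf⟩ = X.glue a b := by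
  refine lp.ext (funext fun i => ?_)
  rw [glue_apply]
  exact (h i.edge).edgeEval_eq _ i.side

theorem orientedTrace_eq (h : X.HasGraphData f a b g) (hf : f ∈ X.H1Max) :
    X.orientedTrace ⟨f, hf⟩ = X.glue (-a) b := by
  refine lp.ext (funext fun i => ?_)
  rw [glue_apply]
  refine (congrArg ((if i.side then 1 else -1) * ·)
    ((h i.edge).edgeEval_eq (hf.1 i.edge) i.side)).trans ?_
  cases i.side <;> simp

/-- Membership in the domain needs square-summable derivatives, which is automatic because g and k
are elements of L²(X), and vertex values in 𝒢, which is `hF`. -/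
theorem laplacian_eq [CompleteSpace G] (h : X.HasGraphData f a b g) {a' b' : X.EdgeForms} {k : X.L2}
    (h' : X.HasGraphData g a' b' k) {F : G} (hF : X.glue a b = F) :
    ∃ hf : f ∈ (X.laplacian G).domain, X.laplacian G ⟨f, hf⟩ = -k ∧
      X.bdry0 G ⟨f, hf⟩ = F ∧
      X.bdry1 G ⟨f, hf⟩ = G.orthogonalProjectionOnto (X.glue (-a') b') := by
  have e := h.deriv_eq h.mem
  have hf : f ∈ X.H2 G := ⟨h.mem, by rw [e]; exact h'.mem, by rw [h.trace_eq, hF]; exact F.2⟩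
  have hd : X.derivH2 G ⟨f, hf⟩ = ⟨g, h'.mem⟩ := Subtype.ext e
  refine ⟨hf, ?_, Subtype.ext ((h.trace_eq h.mem).trans hF), ?_⟩
  · exact congrArg Neg.neg ((congrArg X.deriv hd).trans (h'.deriv_eq _))
  · exact congrArg G.orthogonalProjectionOnto
      ((congrArg X.orientedTrace hd).trans (h'.orientedTrace_eq _))

end HasGraphData

theorem exists_hasGraphData (x : (X.laplacian G).domain) :
    ∃ (g : X.L2) (a b : X.EdgeForms),
      X.HasGraphData x (X.pull false (X.bdry0 G x)) (X.pull true (X.bdry0 G x)) g ∧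
      X.HasGraphData g a b (-X.laplacian G x) := by
  refine ⟨X.derivH2 G x, X.pull false (X.trace (X.derivH2 G x)),
    X.pull true (X.trace (X.derivH2 G x)), hasGraphData_H1Max ⟨x.1, x.2.1⟩, ?_⟩
  have := hasGraphData_H1Max (X.derivH2 G x)
  convert this using 1
  exact neg_neg _

end EdgeGraph

/-! ### Well-posedness of the boundary value problems on the graph -/

namespace EdgeGraph

variable {V E : Type*} (X : EdgeGraph V E) (G : Submodule ℂ X.GMax) [CompleteSpace G]

theorem wellPosed_laplacian {μ : ℂ} {C S : C(ℝ, ℂ)} (h : FundamentalSystem μ C S)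
    (hs : S 1 ≠ 0) :
    WellPosed (X.laplacian G) (X.bdry0 G) (X.bdry1 G) μ (S 1)
      (X.discreteLaplacian G - (1 - C 1) • ContinuousLinearMap.id ℂ G) where
  poisson := by
    obtain ⟨ψ, ψ', φ, φ', h1, h2, h3, h4⟩ := h.exists_poisson hs
    let Q : EdgeL2 → EdgeL2 → G →L[ℂ] X.L2 := fun u v =>
      (lpMap E (ContinuousLinearMap.toSpanSingleton ℂ u) ∘L X.pull false +
        lpMap E (ContinuousLinearMap.toSpanSingleton ℂ v) ∘L X.pull true) ∘L G.subtypeL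
    refine ⟨Q ψ φ, fun F => ?_⟩
    set F₀ := X.pull false (F : X.GMax)
    set F₁ := X.pull true (F : X.GMax)
    have d : X.HasGraphData (Q ψ φ F) F₀ F₁ (Q ψ' φ' F) := fun e => by
      convert! (h1.smul (F₀ e)).add (h3.smul (F₁ e)) using 1
      · ring
      · ring
    have d' : X.HasGraphData (Q ψ' φ' F) ((S 1)⁻¹ • (F₁ - C 1 • F₀)) ((S 1)⁻¹ • (C 1 • F₁ - F₀))
        (-(μ • Q ψ φ F)) := fun e => by
      convert! (h2.smul (F₀ e)).add (h4.smul (F₁ e)) using 1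
      · change (S 1)⁻¹ * (F₁ e - C 1 * F₀ e) = _
        ring
      · change (S 1)⁻¹ * (C 1 * F₁ e - F₀ e) = _
        ring
      · change -(μ • (F₀ e • ψ + F₁ e • φ)) = _
        module
    obtain ⟨hf, e1, e2, e3⟩ := d.laplacian_eq G d' (F := F) (X.glue_pull F)
    refine ⟨hf, by rw [e1, neg_neg], e2, ?_⟩
    -- The heart of the matter: the scaled oriented derivatives are those of Δ_𝒢 before projection,
    -- minus (1 - C(1)) times the vertex values.
    have key : S 1 • X.glue (-((S 1)⁻¹ • (F₁ - C 1 • F₀))) ((S 1)⁻¹ • (C 1 • F₁ - F₀)) =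
        X.glue (F₀ - F₁) (F₁ - F₀) - (1 - C 1) • X.glue F₀ F₁ := by
      simp only [glue, map_sub, map_smul, map_neg, smul_add, smul_sub, smul_neg,
        smul_inv_smul₀ hs]
      module
    rw [e3, ← map_smul G.orthogonalProjectionOnto, key, map_sub, map_smul, X.glue_pull,
      G.orthogonalProjectionOnto_mem_subspace_eq_self, sub_apply, discreteLaplacian_apply]
    rfl
  dirichlet := by
    obtain ⟨D, D', β, hD⟩ := h.exists_dirichlet hs
    let a : Bool → X.L2 →L[ℂ] X.EdgeForms := fun s => lpMap E (β s)
    refine ⟨lpMap E D, G.orthogonalProjectionOnto ∘L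
      (ContinuousLinearMap.adjoint (X.pull true) ∘L a true -
        ContinuousLinearMap.adjoint (X.pull false) ∘L a false), fun y => ?_⟩
    have d : X.HasGraphData (lpMap E D y) 0 0 (lpMap E D' y) := fun e => (hD (y e)).1
    have d' : X.HasGraphData (lpMap E D' y) (a false y) (a true y) (-y + -(μ • lpMap E D y)) :=
      fun e => (hD (y e)).2
    obtain ⟨hf, e1, e2, e3⟩ := d.laplacian_eq G d' (F := 0) (by simp [glue])
    refine ⟨hf, by rw [e1]; abel, e2, ?_⟩
    rw [e3]
    simp only [glue, ContinuousLinearMap.comp_apply, sub_apply, map_neg]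
    congr 1
    abel
  unique := by
    intro x hx h0
    obtain ⟨g, a, b, d, d'⟩ := exists_hasGraphData G x
    rw [h0] at d
    rw [hx] at d'
    refine Subtype.ext (lp.ext (funext fun e => ?_))
    exact h.dirichlet_unique hs (by simpa using d e) (d' e)
  surjective := by
    intro F
    obtain ⟨p, p', p'', q, q', q'', h1, h2, h3, h4⟩ := exists_edge_neumann
    -- The minus sign at initial vertices cancels the one in the oriented evaluation.
    let Q : EdgeL2 → EdgeL2 → X.L2 := fun u v =>
      lpMap E (ContinuousLinearMap.toSpanSingleton ℂ u) (-X.pull false (F : X.GMax)) +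
        lpMap E (ContinuousLinearMap.toSpanSingleton ℂ v) (X.pull true (F : X.GMax))
    have d : X.HasGraphData (Q p q) 0 0 (Q p' q') := fun e => by
      convert! (h1.smul (-X.pull false (F : X.GMax) e)).add
        (h3.smul (X.pull true (F : X.GMax) e)) using 1 <;> simp
    have d' : X.HasGraphData (Q p' q') (-X.pull false (F : X.GMax)) (X.pull true (F : X.GMax))
        (Q p'' q'') := fun e => by
      convert! (h2.smul (-X.pull false (F : X.GMax) e)).add
        (h4.smul (X.pull true (F : X.GMax) e)) using 1 <;> simp
    obtain ⟨hf, -, e2, e3⟩ := d.laplacian_eq G d' (F := 0) (by simp [glue])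
    refine ⟨⟨_, hf⟩, e2, ?_⟩
    rw [e3, neg_neg, glue_pull, G.orthogonalProjectionOnto_mem_subspace_eq_self]

/-- All solution operators act componentwise, and the summand m² shifts the spectral parameter. -/
theorem wellPosed_laplacianSym {m : ℝ} {z s : ℂ} {T : G →L[ℂ] G}
    (W : WellPosed (X.laplacian G) (X.bdry0 G) (X.bdry1 G) (z - (m : ℂ) ^ 2) s T) :
    WellPosed (X.laplacianSym G m) (X.bdrySym0 G m) (X.bdrySym1 G m) z s (X.tensorId G T) where
  poisson := by
    obtain ⟨P, hP⟩ := W.poisson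
    refine ⟨(WithLp.prodContinuousLinearEquiv 2 ℂ X.L2 X.L2).symm.toContinuousLinearMap ∘L
      (P.prodMap P) ∘L (WithLp.prodContinuousLinearEquiv 2 ℂ G G).toContinuousLinearMap,
      fun F => ?_⟩
    obtain ⟨h, h1, h2, h3⟩ := hP F.fst
    obtain ⟨g, g1, g2, g3⟩ := hP F.snd
    refine ⟨⟨h, g⟩, ?_, ?_, ?_⟩
    · refine congrArg (WithLp.toLp 2) (Prod.ext ?_ ?_)
      · refine (congrArg (· + (m : ℂ) ^ 2 • P F.fst) h1).trans ?_
        change _ = z • P F.fst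
        module
      · refine (congrArg (· + (m : ℂ) ^ 2 • P F.snd) g1).trans ?_
        change _ = z • P F.snd
        module
    · exact congrArg (WithLp.toLp 2) (Prod.ext h2 g2)
    · exact congrArg (WithLp.toLp 2) (Prod.ext h3 g3)
  dirichlet := by
    obtain ⟨D, B, hD⟩ := W.dirichlet
    refine ⟨(WithLp.prodContinuousLinearEquiv 2 ℂ X.L2 X.L2).symm.toContinuousLinearMap ∘L
      (D.prodMap D) ∘L (WithLp.prodContinuousLinearEquiv 2 ℂ X.L2 X.L2).toContinuousLinearMap,
      (WithLp.prodContinuousLinearEquiv 2 ℂ G G).symm.toContinuousLinearMap ∘L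
      (B.prodMap B) ∘L (WithLp.prodContinuousLinearEquiv 2 ℂ X.L2 X.L2).toContinuousLinearMap,
      fun y => ?_⟩
    obtain ⟨h, h1, h2, h3⟩ := hD y.fst
    obtain ⟨g, g1, g2, g3⟩ := hD y.snd
    refine ⟨⟨h, g⟩, ?_, ?_, ?_⟩
    · refine congrArg (WithLp.toLp 2) (Prod.ext ?_ ?_)
      · refine (congrArg (· + (m : ℂ) ^ 2 • D y.fst) h1).trans ?_
        change _ = y.fst + z • D y.fst
        module
      · refine (congrArg (· + (m : ℂ) ^ 2 • D y.snd) g1).trans ?_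
        change _ = y.snd + z • D y.snd
        module
    · exact congrArg (WithLp.toLp 2) (Prod.ext h2 g2)
    · exact congrArg (WithLp.toLp 2) (Prod.ext h3 g3)
  unique := by
    rintro ⟨x, hx1, hx2⟩ hx h0
    have k1 := congrArg WithLp.fst hx
    have k2 := congrArg WithLp.snd hx
    have l1 := W.unique ⟨x.fst, hx1⟩ (by
      rw [sub_smul]; exact eq_sub_of_add_eq k1) (congrArg WithLp.fst h0)
    have l2 := W.unique ⟨x.snd, hx2⟩ (by
      rw [sub_smul]; exact eq_sub_of_add_eq k2) (congrArg WithLp.snd h0)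
    refine Subtype.ext (congrArg (WithLp.toLp 2) (Prod.ext ?_ ?_))
    · exact congrArg Subtype.val l1
    · exact congrArg Subtype.val l2
  surjective := by
    intro F
    obtain ⟨x, h1, h2⟩ := W.surjective F.fst
    obtain ⟨y, g1, g2⟩ := W.surjective F.snd
    exact ⟨⟨WithLp.toLp 2 (x, y), x.2, y.2⟩, congrArg (WithLp.toLp 2) (Prod.ext h1 g1),
      congrArg (WithLp.toLp 2) (Prod.ext h2 g2)⟩

end EdgeGraph

/-! ### The excluded Dirichlet eigenvalues and the conclusion -/

theorem csinc_ne_zero {w : ℂ} (hw : ∀ k : ℕ, 1 ≤ k → w ^ 2 ≠ ((Real.pi * k) ^ 2 : ℝ)) :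
    csinc w ≠ 0 := by
  rw [csinc]
  split_ifs with h
  · exact one_ne_zero
  · refine div_ne_zero (fun hsin => ?_) h
    -- A zero of sin is πk with an integer k; here k ≠ 0 because w ≠ 0, and squaring removes its
    -- sign.
    obtain ⟨k, rfl⟩ := Complex.sin_eq_zero_iff.1 hsin
    have hk : k ≠ 0 := by
      rintro rfl
      simp at h
    refine hw k.natAbs (Int.natAbs_pos.2 hk) ?_
    have : ((k.natAbs : ℂ)) ^ 2 = (k : ℂ) ^ 2 := by
      rw [Nat.cast_natAbs, ← Int.cast_pow, sq_abs, Int.cast_pow]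
    push_cast
    rw [mul_pow, mul_pow, this]
    ring

theorem complex_sqrt_sq (a : ℂ) : Complex.sqrt a ^ 2 = a := by
  simp [Complex.sqrt]

theorem EdgeGraph.mem_pmapSpectrum_laplacianSymRestr {V E : Type*} (X : EdgeGraph V E)
    (G : Submodule ℂ X.GMax) [CompleteSpace G] (m : ℝ) (M : X.BdrySym G →L[ℂ] X.BdrySym G)
    {z w : ℂ} (hw : w ^ 2 = z - (m : ℂ) ^ 2) (hs : csinc w ≠ 0) :
    z ∈ pmapSpectrum (X.laplacianSymRestr G m M) ↔
      (0 : ℂ) ∈ spectrum ℂ (X.tensorId G (X.discreteLaplacian G -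
        (1 - Complex.cos w) • ContinuousLinearMap.id ℂ G) - csinc w • M) := by
  obtain ⟨C, S, h, hC, hS⟩ := exists_fundamentalSystem w
  rw [hw] at h
  rw [← hS] at hs ⊢
  rw [← hC]
  exact (X.wellPosed_laplacianSym G (X.wellPosed_laplacian G h hs)).mem_pmapSpectrum_iff hs M

end QuantumGraph
end

theorem theorem7p1 {V E : Type*} (X : QuantumGraph.EdgeGraph V E)
    (G : Submodule ℂ X.GMax) [CompleteSpace G] (m : ℝ)
    (M : X.BdrySym G →L[ℂ] X.BdrySym G) (hM : IsSelfAdjoint M) (z : ℂ)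
    (hz : ∀ k : ℕ, 1 ≤ k → z ≠ ((Real.pi * k) ^ 2 + m ^ 2 : ℝ)) :
    z ∈ QuantumGraph.pmapSpectrum (X.laplacianSymRestr G m M) ↔
      (0 : ℂ) ∈ spectrum ℂ
        (X.tensorId G (X.discreteLaplacian G -
            (1 - Complex.cos (Complex.sqrt (z - (m : ℂ) ^ 2))) • ContinuousLinearMap.id ℂ G) -
          QuantumGraph.csinc (Complex.sqrt (z - (m : ℂ) ^ 2)) • M) := by
  have hw := QuantumGraph.complex_sqrt_sq (z - (m : ℂ) ^ 2)
  refine X.mem_pmapSpectrum_laplacianSymRestr G m M hw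
    (QuantumGraph.csinc_ne_zero fun k hk e => hz k hk ?_)
  rw [hw] at e
  rw [Complex.ofReal_add, Complex.ofReal_pow m]
  exact sub_eq_iff_eq_add.1 e
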